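/- Let $n\ge 1$ and let $f=(f_1,\dots,f_n)$ be polynomials in $X_1,\dots,X_n$ with non-negative real coefficients and total degree at most $2$. Assume that * $f$ is feasible: $f(y)=y$ for some $y\in\mathbb{R}_{\ge 0}^n$; then $f$ has a (componentwise) least fixed point $\mu f$ in $\mathbb{R}_{\ge 0}^n$; * $f$ is clean: for every $j$ there is a $k\in\mathbb{N}$ with $(f^k(0))_j>0$, where $f^k$ is the $k$-fold iterate of $f$; * $f$ is strongly connected: for all $j,l$, the pair $(j,l)$ lies in the reflexive transitive closure of the relation "$\partial f_j/\partial X_l$ is not the zero polynomial". Let $c_{\min}$ be the smallest nonzero coefficient of $f$, let $\mu_{\min}$ and $\mu_{\max}$ be the smallest and the largest component of $\mu f$, and put $$k_f = n\cdot\log_2\left(\frac{\mu_{\max}}{c_{\min}\cdot\mu_{\min}\cdot\min\{\mu_{\min},1\}}\right).$$ Let $\nu^{(0)}=0$ and $\nu^{(k+1)}=\nu^{(k)}+(\mathrm{Id}-f'(\nu^{(k)}))^{-1}\bigl(f(\nu^{(k)})-\nu^{(k)}\bigr)$ be the Newton sequence, where $f'$ is the Jacobian matrix of $f$. Then the Newton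 sequence is well defined, i.e. all the matrices $\mathrm{Id}-f'(\nu^{(k)})$ are invertible, and for every integer $i\ge 0$ the iterate $\nu^{(\max\{\lceil k_f\rceil,0\}+i)}$ has at least $i$ valid bits of $\mu f$, that is, $$\frac{|(\mu f)_j-\nu^{(\max\{\lceil k_f\rceil,0\}+i)}_j|}{|(\mu f)_j|}\le 2^{-i}\qquad\text{for every } 1\le j\le n.$$ -/

import Mathlib

namespace MSP

/-- A system `f = (f₁, …, fₙ)` of real polynomials in the variables `X₁, …, Xₙ`. -/
abbrev PolySystem (n : ℕ) := Fin n → MvPolynomial (Fin n) ℝ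

variable {n : ℕ}

/-- The value `f(x)` of the system at a vector `x`. -/
noncomputable def value (f : PolySystem n) (x : Fin n → ℝ) : Fin n → ℝ :=
  fun i => MvPolynomial.eval x (f i)

/-- All coefficients are non-negative. -/
def NonnegCoeffs (f : PolySystem n) : Prop :=
  ∀ i d, 0 ≤ MvPolynomial.coeff d (f i)

/-- The fixed points of `f` in the non-negative orthant. -/
def fixedPoints (f : PolySystem n) : Set (Fin n → ℝ) :=
  {y | 0 ≤ y ∧ value f y = y}

/-- The system has a non-negative fixed point. -/
def Feasible (f : PolySystem n) : Prop := (fixedPoints f).Nonempty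

/-- The Kleene sequence `κ⁰ = 0`, `κᵏ⁺¹ = f(κᵏ)`. -/
noncomputable def kleene (f : PolySystem n) (k : ℕ) : Fin n → ℝ := (value f)^[k] 0

/-- Every variable is productive: some Kleene iterate is positive in that component. -/
def Clean (f : PolySystem n) : Prop := ∀ i, ∃ k, 0 < kleene f k i

/-- A monotone system of polynomials, by convention clean and feasible. -/
structure IsMSP (f : PolySystem n) : Prop where
  nonneg : NonnegCoeffs f
  clean : Clean f
  feasible : Feasible f

/-- All monomials have degree at most `2`. -/
def Quadratic (f : PolySystem n) : Prop := ∀ i, (f i).totalDegree ≤ 2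

/-- `X_i` depends directly on `X_k`: the polynomial `∂f_i/∂X_k` is not zero. -/
def DependsDirectly (f : PolySystem n) (i k : Fin n) : Prop :=
  MvPolynomial.pderiv k (f i) ≠ 0

/-- All variables depend on each other, where dependence is the reflexive transitive closure
of direct dependence. -/
def StronglyConnected (f : PolySystem n) : Prop :=
  ∀ i k, Relation.ReflTransGen (DependsDirectly f) i k

/-- The Jacobian matrix `f'(x)`. -/
noncomputable def jacobian (f : PolySystem n) (x : Fin n → ℝ) : Matrix (Fin n) (Fin n) ℝ :=
  Matrix.of fun i j => MvPolynomial.eval x (MvPolynomial.pderiv j (f i))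

/-- The Newton operator `x ↦ x + (Id - f'(x))⁻¹ (f(x) - x)`
(meaningful where `Id - f'(x)` is invertible). -/
noncomputable def newtonOp (f : PolySystem n) (x : Fin n → ℝ) : Fin n → ℝ :=
  x + Matrix.mulVec (1 - jacobian f x)⁻¹ (value f x - x)

/-- The Newton sequence `ν⁰ = 0`, `νᵏ⁺¹ = N_f(νᵏ)`. -/
noncomputable def newton (f : PolySystem n) (k : ℕ) : Fin n → ℝ := (newtonOp f)^[k] 0

/-- The least fixed point `μf`, as the (componentwise) infimum of the non-negative fixed points.
It is the least element of that set by `lfp_isLeast`. -/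
noncomputable def lfp (f : PolySystem n) : Fin n → ℝ := sInf (fixedPoints f)

/-- The smallest nonzero coefficient (the set is finite, and nonempty if some `f_i` is nonzero). -/
noncomputable def cMin (f : PolySystem n) : ℝ :=
  sInf {c | c ≠ 0 ∧ ∃ i d, MvPolynomial.coeff d (f i) = c}

/-- The smallest component of `μf` (for `n ≥ 1`). -/
noncomputable def muMin (f : PolySystem n) : ℝ := ⨅ i, lfp f i

/-- The largest component of `μf` (for `n ≥ 1`). -/
noncomputable def muMax (f : PolySystem n) : ℝ := ⨆ i, lfp f i

/-- `k_f = n · log₂ (μ_max / (c_min · μ_min · min {μ_min, 1}))`. -/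
noncomputable def threshold (f : PolySystem n) : ℝ :=
  n * Real.logb 2 (muMax f / (cMin f * muMin f * min (muMin f) 1))

/-- The vector `ν` has (at least) `i` valid bits of `μ`. -/
def HasValidBits (i : ℕ) (μ ν : Fin n → ℝ) : Prop :=
  ∀ j, |μ j - ν j| / |μ j| ≤ (2 : ℝ) ^ (-(i : ℤ))

theorem value_mono {f : PolySystem n} (hf : NonnegCoeffs f) {x y : Fin n → ℝ}
    (hx : 0 ≤ x) (hxy : x ≤ y) : value f x ≤ value f y := by
  intro i
  simp only [value, MvPolynomial.eval_eq]
  refine Finset.sum_le_sum fun d _ => mul_le_mul_of_nonneg_left ?_ (hf i d)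
  exact Finset.prod_le_prod (fun j _ => pow_nonneg (hx j) _)
    (fun j _ => pow_le_pow_left₀ (hx j) (hxy j) _)

theorem value_nonneg {f : PolySystem n} (hf : NonnegCoeffs f) {x : Fin n → ℝ}
    (hx : 0 ≤ x) : 0 ≤ value f x := by
  intro i
  simp only [value, MvPolynomial.eval_eq]
  exact Finset.sum_nonneg fun d _ => mul_nonneg (hf i d)
    (Finset.prod_nonneg fun j _ => pow_nonneg (hx j) _)

theorem kleene_succ (f : PolySystem n) (k : ℕ) : kleene f (k + 1) = value f (kleene f k) := by
  simp [kleene, Function.iterate_succ_apply']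

/-- A feasible system with non-negative coefficients has a least fixed point, and it is `lfp f`. -/
theorem lfp_isLeast {f : PolySystem n} (hf : NonnegCoeffs f) (h : Feasible f) :
    IsLeast (fixedPoints f) (lfp f) := by
  have h0 : ∀ k, 0 ≤ kleene f k := by
    intro k
    induction k with
    | zero => exact le_refl _
    | succ k ih => rw [kleene_succ]; exact value_nonneg hf ih
  have hm : Monotone (kleene f) := by
    refine monotone_nat_of_le_succ fun k => ?_
    induction k with
    | zero => exact h0 1
    | succ k ih =>
      rw [kleene_succ f (k + 1)]
      nth_rewrite 1 [kleene_succ f k]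
      exact value_mono hf (h0 k) ih
  have hle : ∀ y ∈ fixedPoints f, ∀ k, kleene f k ≤ y := by
    intro y hy k
    induction k with
    | zero => exact hy.1
    | succ k ih =>
      rw [kleene_succ, ← hy.2]
      exact value_mono hf (h0 k) ih
  obtain ⟨y, hy⟩ := h
  have hb : BddAbove (Set.range (kleene f)) :=
    ⟨y, by rintro _ ⟨k, rfl⟩; exact hle y hy k⟩
  have ht := tendsto_atTop_ciSup hm hb
  have hc : Continuous (value f) :=
    continuous_pi fun i => MvPolynomial.continuous_eval (f i)
  have ht' := (hc.tendsto _).comp ht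
  have ht2 := (Filter.tendsto_add_atTop_iff_nat 1).2 ht
  have hfix : value f (⨆ k, kleene f k) = ⨆ k, kleene f k := by
    refine tendsto_nhds_unique ht' ?_
    convert ht2 using 1
    funext k
    exact (kleene_succ f k).symm
  have hL : IsLeast (fixedPoints f) (⨆ k, kleene f k) :=
    ⟨⟨le_ciSup hb 0, hfix⟩, fun z hz => ciSup_le (hle z hz)⟩
  have : lfp f = ⨆ k, kleene f k := hL.csInf_eq
  rw [this]
  exact hL

end MSP

/-!
For a quadratic `f` Taylor's formula reads
`f(y) = f(x) + f'(x)(y - x) + ½ (f'(y) - f'(x))(y - x)`, so a Newton step `N(x)` satisfies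
`(1 - f'(x))(μ - N(x)) = ½ (f'(μ) - f'(x))(μ - x)` with `μ = μf`. If `d` is a *cone vector*,
i.e. `f'(μ) d ≤ d`, then `μ - x ≤ 2c d` implies `(1 - f'(x))(μ - N(x)) ≤ (1 - f'(x))(c d)`, and
`1 - f'(x)` can be cancelled because its inverse is non-negative: measured along `d`, every Newton
step halves the error. Cone vectors arise as limits of the normalised Kleene errors. Scaled such
that `μ ≤ d` with equality in some component, `d` is at most `2 ^ ⌈k_f⌉ μ`, because `f'(μ) d ≤ d`
and strong connectedness bound the ratios of its components.
-/

namespace MSP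

open Filter Finset Matrix MvPolynomial Relation Topology

section Arithmetic

theorem pow_le_two_pow_ceil_mul_logb {a : ℝ} (ha : 0 < a) (n : ℕ) :
    a ^ n ≤ 2 ^ ⌈n * Real.logb 2 a⌉₊ :=
  calc a ^ n = (2 : ℝ) ^ (n * Real.logb 2 a) := by
        rw [mul_comm, Real.rpow_mul two_pos.le, Real.rpow_logb two_pos (by norm_num) ha,
          Real.rpow_natCast]
    _ ≤ (2 : ℝ) ^ (⌈n * Real.logb 2 a⌉₊ : ℝ) :=
        Real.rpow_le_rpow_of_exponent_le one_le_two (Nat.le_ceil _)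
    _ = 2 ^ ⌈n * Real.logb 2 a⌉₊ := Real.rpow_natCast _ _

theorem div_pow_le_div_mul_pow_mul {𝕜 : Type*} [Field 𝕜] [LinearOrder 𝕜]
    [IsStrictOrderedRing 𝕜] {a b q : 𝕜} (ha : 0 < a) (hab : a ≤ b) (hq0 : 0 < q)
    (hq1 : q ≤ 1) (k : ℕ) : b / q ^ k ≤ (b / (q * a)) ^ (k + 1) * a := by
  have hb : 0 < b := ha.trans_le hab
  have hinv : q⁻¹ ≤ b / (q * a) := by
    rw [inv_eq_one_div, div_le_div_iff₀ hq0 (by positivity), one_mul, mul_comm b]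
    gcongr
  have hdiv : b / a ≤ b / (q * a) :=
    div_le_div_of_nonneg_left hb.le (by positivity) (mul_le_of_le_one_left ha.le hq1)
  calc b / q ^ k = q⁻¹ ^ k * (b / a) * a := by
        rw [mul_assoc, div_mul_cancel₀ b ha.ne', inv_pow, inv_mul_eq_div]
    _ ≤ (b / (q * a)) ^ k * (b / (q * a)) * a := by gcongr
    _ = (b / (q * a)) ^ (k + 1) * a := by rw [pow_succ]

theorem exists_le_smul_and_apply_eq {ι 𝕜 : Type*} [Finite ι] [Nonempty ι] [Field 𝕜]
    [LinearOrder 𝕜] [IsStrictOrderedRing 𝕜] (u : ι → 𝕜) {v : ι → 𝕜} (hv : ∀ i, 0 < v i) :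
    ∃ (t : 𝕜) (i : ι), u ≤ t • v ∧ u i = (t • v) i := by
  obtain ⟨i, hi⟩ := Finite.exists_max fun j => u j / v j
  refine ⟨u i / v i, i, fun j => (div_le_iff₀ (hv j)).1 (hi j), ?_⟩
  exact (div_mul_cancel₀ _ (hv i).ne').symm

end Arithmetic

section Relation

variable {ι : Type*} {r : ι → ι → Prop}

theorem exists_rel_of_reflTransGen {P : ι → Prop} {i j : ι} (hij : ReflTransGen r i j)
    (hi : P i) (hj : ¬ P j) : ∃ a b, P a ∧ r a b ∧ ¬ P b := by
  contrapose! hj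
  induction hij with
  | refl => exact hi
  | tail _ hab ih => exact hj _ _ ih hab

theorem eq_univ_of_forall_ne_succ [Fintype ι] {S : ℕ → Finset ι} (hS : Monotone S)
    (h0 : (S 0).Nonempty) (hne : ∀ k, S k ≠ univ → S k ≠ S (k + 1)) :
    S (Fintype.card ι - 1) = univ := by
  have hgrow : ∀ k, S k = univ ∨ k < #(S k) := by
    intro k
    induction k with
    | zero => exact Or.inr h0.card_pos
    | succ k ih =>
      have hsub := hS k.le_succ
      by_cases hk : S k = univ
      · exact Or.inl (univ_subset_iff.1 (hk ▸ hsub))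
      · have := card_lt_card (hsub.ssubset_of_ne (hne k hk))
        have := ih.resolve_left hk
        exact Or.inr (by lia)
  refine (hgrow _).elim id fun h => eq_univ_of_card _ ?_
  have := card_le_univ (S (Fintype.card ι - 1))
  lia

variable {𝕜 : Type*} [Semiring 𝕜] [LinearOrder 𝕜] [IsStrictOrderedRing 𝕜]

theorem pow_card_sub_one_mul_le [Fintype ι] (hr : ∀ i j, ReflTransGen r i j) {w : ι → 𝕜}
    (hw : 0 ≤ w) {q : 𝕜} (hq : 0 ≤ q) (hq1 : q ≤ 1) (hstep : ∀ i l, r i l → q * w l ≤ w i)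
    (i j : ι) : q ^ (Fintype.card ι - 1) * w j ≤ w i := by
  let S : ℕ → Finset ι := fun k => {l | q ^ k * w l ≤ w i}
  have mem_S {k l} : l ∈ S k ↔ q ^ k * w l ≤ w i := by simp [S]
  have hmono : Monotone S := fun k m hkm l hl => mem_S.2 <|
    (mul_le_mul_of_nonneg_right (pow_le_pow_of_le_one hq hq1 hkm) (hw l)).trans (mem_S.1 hl)
  have hi : i ∈ S 0 := mem_S.2 (by simp)
  have hne : ∀ k, S k ≠ univ → S k ≠ S (k + 1) := by
    intro k hk heq
    obtain ⟨l, hl⟩ : ∃ l, l ∉ S k := by simpa [eq_univ_iff_forall] using hk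
    obtain ⟨a, b, ha, hab, hb⟩ :=
      exists_rel_of_reflTransGen (P := (· ∈ S k)) (hr i l) (hmono (Nat.zero_le k) hi) hl
    refine hb (heq ▸ mem_S.2 ?_)
    calc q ^ (k + 1) * w b = q ^ k * (q * w b) := by rw [pow_succ, mul_assoc]
      _ ≤ q ^ k * w a := mul_le_mul_of_nonneg_left (hstep a b hab) (pow_nonneg hq k)
      _ ≤ w i := mem_S.1 ha
  exact mem_S.1 (eq_univ_of_forall_ne_succ hmono ⟨i, hi⟩ hne ▸ mem_univ j)

theorem le_one_of_forall_mul_le [Finite ι] [Nonempty ι] (hr : ∀ i, ∃ l, r i l) {w : ι → 𝕜}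
    (hw : ∀ i, 0 < w i) {q : 𝕜} (hstep : ∀ i l, r i l → q * w l ≤ w i) : q ≤ 1 := by
  obtain ⟨i, hi⟩ := Finite.exists_min w
  obtain ⟨l, hil⟩ := hr i
  by_contra! hq
  exact ((lt_mul_of_one_lt_left (hw l) hq).trans_le (hstep i l hil)).not_ge (hi l)

theorem exists_rel_of_forall_reflTransGen [Nontrivial ι] (hr : ∀ i j, ReflTransGen r i j) (i : ι) :
    ∃ l, r i l := by
  obtain ⟨j, hj⟩ := exists_ne i
  obtain ⟨_, b, rfl, hab, -⟩ := exists_rel_of_reflTransGen (P := (· = i)) (hr i j) rfl hj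
  exact ⟨b, hab⟩

end Relation

section NonnegMatrix

variable {ι 𝕜 : Type*} [Fintype ι] [Semiring 𝕜] [LinearOrder 𝕜] [IsStrictOrderedRing 𝕜]
  {A : Matrix ι ι 𝕜} {v : ι → 𝕜}

theorem mul_le_mulVec (hA : ∀ i j, 0 ≤ A i j) (hv : 0 ≤ v) (i j : ι) :
    A i j * v j ≤ (A *ᵥ v) i :=
  single_le_sum (f := fun l => A i l * v l) (fun l _ => mul_nonneg (hA i l) (hv l)) (mem_univ j)

theorem mulVec_nonneg (hA : ∀ i j, 0 ≤ A i j) (hv : 0 ≤ v) : 0 ≤ A *ᵥ v :=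
  fun i => dotProduct_nonneg_of_nonneg (hA i) hv

theorem eq_zero_of_mulVec_apply_nonpos (hA : ∀ i j, 0 ≤ A i j) (hv : ∀ j, 0 < v j) {i : ι}
    (hi : (A *ᵥ v) i ≤ 0) (j : ι) : A i j = 0 :=
  (nonpos_of_mul_nonpos_left ((mul_le_mulVec hA (fun j => (hv j).le) i j).trans hi)
    (hv j)).antisymm (hA i j)

/-- On the zero set of `y`, where `r i l` forces `A i l > 0`, the inequality `A y ≤ y` propagates
zeros along `r`. -/
theorem pos_or_eq_zero_of_mulVec_le {r : ι → ι → Prop} (hr : ∀ i j, ReflTransGen r i j)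
    (hA : ∀ i j, 0 ≤ A i j) {y : ι → 𝕜} (hy : 0 ≤ y) (hAy : A *ᵥ y ≤ y)
    (hdep : ∀ i, y i = 0 → ∀ l, r i l → 0 < A i l) : (∀ i, 0 < y i) ∨ y = 0 := by
  by_contra! ⟨⟨i, hi⟩, hne⟩
  obtain ⟨j, hj⟩ := Function.ne_iff.1 hne
  obtain ⟨a, b, ha, hab, hb⟩ :=
    exists_rel_of_reflTransGen (P := (y · = 0)) (hr i j) (hi.antisymm (hy i)) hj
  have hAb : A a b * y b ≤ 0 := (mul_le_mulVec hA hy a b).trans ((hAy a).trans ha.le)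
  exact hb ((nonpos_of_mul_nonpos_right hAb (hdep a ha b hab)).antisymm (hy b))

end NonnegMatrix

section MonotoneMatrix

variable {ι 𝕜 : Type*} [Fintype ι]

/-- Monotone matrices in the sense of Collatz: the invertible matrices whose inverse has
non-negative entries, characterised without mentioning the inverse. -/
def IsMonotoneMatrix [Semiring 𝕜] [PartialOrder 𝕜] (M : Matrix ι ι 𝕜) : Prop :=
  ∀ ⦃w⦄, 0 ≤ M *ᵥ w → 0 ≤ w

variable [Field 𝕜] [LinearOrder 𝕜] [IsStrictOrderedRing 𝕜] {A : Matrix ι ι 𝕜} {v : ι → 𝕜}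

theorem IsMonotoneMatrix.isUnit_det [DecidableEq ι] {M : Matrix ι ι 𝕜}
    (hM : IsMonotoneMatrix M) : IsUnit M.det := by
  rw [← isUnit_iff_isUnit_det, ← mulVec_injective_iff_isUnit]
  have hle : ∀ u v, M *ᵥ u = M *ᵥ v → u ≤ v := fun u v huv =>
    sub_nonneg.1 (hM (by rw [mulVec_sub, huv, sub_self]))
  exact fun u v huv => (hle u v huv).antisymm (hle v u huv.symm)

/-- If `w` had a negative component, then `w + t v ≥ 0` for a `t > 0` that makes a component
vanish, and the zeros of `w + t v` would propagate along `r`. -/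
theorem isMonotoneMatrix_one_sub [DecidableEq ι] {r : ι → ι → Prop}
    (hr : ∀ i j, ReflTransGen r i j) (hA : ∀ i j, 0 ≤ A i j) (hv : ∀ i, 0 < v i)
    (hAv : A *ᵥ v ≤ v) (hne : A *ᵥ v ≠ v)
    (hdep : ∀ i, (A *ᵥ v) i = v i → ∀ l, r i l → 0 < A i l) : IsMonotoneMatrix (1 - A) := by
  intro w hw
  rw [sub_mulVec, one_mulVec, sub_nonneg] at hw
  by_contra hneg
  obtain ⟨i₀, hi₀⟩ : ∃ i, w i < 0 := by simpa [Pi.le_def] using hneg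
  have : Nonempty ι := ⟨i₀⟩
  obtain ⟨t, i, htv, hi⟩ := exists_le_smul_and_apply_eq (-w) hv
  have ht : 0 < t :=
    pos_of_mul_pos_left ((neg_pos.2 hi₀).trans_le (htv i₀)) (hv i₀).le
  have hy : 0 ≤ w + t • v := neg_le_iff_add_nonneg'.1 htv
  have hyi : (w + t • v) i = 0 := by simp [← hi]
  have hgap : A *ᵥ (w + t • v) + t • (v - A *ᵥ v) ≤ w + t • v := by
    rw [mulVec_add, mulVec_smul, smul_sub, add_add_sub_cancel]
    gcongr
  have hAy : A *ᵥ (w + t • v) ≤ w + t • v :=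
    (le_add_of_nonneg_right (smul_nonneg ht.le (sub_nonneg.2 hAv))).trans hgap
  have heq : ∀ l, (w + t • v) l = 0 → (A *ᵥ v) l = v l := by
    intro l hl
    have hl_gap : t * (v l - (A *ᵥ v) l) ≤ 0 :=
      (le_add_of_nonneg_left (mulVec_nonneg hA hy l)).trans ((hgap l).trans hl.le)
    exact (hAv l).antisymm (sub_nonpos.1 (nonpos_of_mul_nonpos_right hl_gap ht))
  rcases pos_or_eq_zero_of_mulVec_le hr hA hy hAy fun l hl => hdep l (heq l hl) with h | h
  · exact (h i).ne' hyi
  · exact hne (funext fun l => heq l (congrFun h l))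

theorem exists_nonneg_mulVec_le_of_tendsto {A : Matrix ι ι ℝ} {B : ℕ → Matrix ι ι ℝ}
    {u : ℕ → ι → ℝ} (hB : Tendsto B atTop (𝓝 A)) (hu : ∀ k, 0 ≤ u k) (hne : ∀ k, u k ≠ 0)
    (hBu : ∀ k, B k *ᵥ u k ≤ u k) : ∃ d, 0 ≤ d ∧ d ≠ 0 ∧ A *ᵥ d ≤ d := by
  let e : ℕ → ι → ℝ := fun k => ‖u k‖⁻¹ • u k
  have he : ∀ k, e k ∈ Metric.sphere 0 1 := fun k => by
    simp [e, norm_smul, norm_ne_zero_iff.2 (hne k)]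
  have hBe : ∀ k, B k *ᵥ e k ≤ e k := fun k => by
    rw [mulVec_smul]
    exact smul_le_smul_of_nonneg_left (hBu k) (by positivity)
  obtain ⟨d, hd, φ, hφ, hlim⟩ := (isCompact_sphere (0 : ι → ℝ) 1).tendsto_subseq he
  have hlimB : Tendsto (fun k => B (φ k) *ᵥ e (φ k)) atTop (𝓝 (A *ᵥ d)) := by
    have hcont : Continuous fun p : Matrix ι ι ℝ × (ι → ℝ) => p.1 *ᵥ p.2 :=
      continuous_fst.matrix_mulVec continuous_snd
    exact (hcont.tendsto (A, d)).comp ((hB.comp hφ.tendsto_atTop).prodMk_nhds hlim)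
  refine ⟨d, ge_of_tendsto' hlim fun k => smul_nonneg (by positivity) (hu _), ?_,
    le_of_tendsto_of_tendsto' hlimB hlim fun k => hBe _⟩
  exact ne_zero_of_mem_unit_sphere ⟨d, hd⟩

end MonotoneMatrix

section Polynomial

variable {σ R : Type*}

theorem monomial_eq_of_degree_le_two [CommSemiring R] {d : σ →₀ ℕ} (hd : d.degree ≤ 2)
    (c : R) : monomial d c = C c ∨ (∃ a, monomial d c = C c * X a) ∨
      ∃ a b, monomial d c = C c * (X a * X b) := by
  classical
  obtain ⟨s, rfl⟩ := Multiset.toFinsupp.surjective d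
  have hs : s.card ≤ 2 := by
    rw [← Multiset.toFinsupp_toMultiset s]
    exact (Finsupp.card_toMultiset _).trans_le hd
  interval_cases h : s.card
  · obtain rfl := Multiset.card_eq_zero.1 h
    exact Or.inl (by simp)
  · obtain ⟨a, rfl⟩ := Multiset.card_eq_one.1 h
    exact Or.inr (Or.inl ⟨a, by simp [C_mul_X_eq_monomial]⟩)
  · obtain ⟨a, b, rfl⟩ := Multiset.card_eq_two.1 h
    refine Or.inr (Or.inr ⟨a, b, ?_⟩)
    rw [X, X, monomial_mul, C_mul_monomial]
    simp [← Multiset.singleton_add]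

theorem two_mul_eval_sub_eval [Fintype σ] [CommRing R] {p : MvPolynomial σ R}
    (hp : p.totalDegree ≤ 2) (x y : σ → R) :
    2 * (eval y p - eval x p) =
      ∑ j, (eval x (pderiv j p) + eval y (pderiv j p)) * (y j - x j) := by
  classical
  have hmonomial : ∀ d ∈ p.support, ∀ c : R,
      2 * (eval y (monomial d c) - eval x (monomial d c)) =
        ∑ j, (eval x (pderiv j (monomial d c)) + eval y (pderiv j (monomial d c))) *
          (y j - x j) := by
    intro d hd c
    rcases monomial_eq_of_degree_le_two ((le_totalDegree hd).trans hp) c with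
      h | ⟨a, h⟩ | ⟨a, b, h⟩
    · simp [h]
    · simp only [h, map_mul, eval_C, eval_X, Derivation.leibniz, pderiv_X, Pi.single_apply,
        smul_eq_mul, mul_ite, mul_one, mul_zero, derivation_C, add_zero, apply_ite (eval _),
        map_zero, add_mul, ite_mul, zero_mul, sum_add_distrib, sum_ite_eq, mem_univ, if_true]
      ring
    · simp only [h, map_mul, eval_C, eval_X, Derivation.leibniz, pderiv_X, Pi.single_apply,
        smul_eq_mul, mul_ite, mul_one, mul_zero, mul_add, derivation_C, add_zero, map_add,
        apply_ite (eval _), map_zero, add_mul, ite_mul, zero_mul, sum_add_distrib, sum_ite_eq,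
        mem_univ, if_true]
      ring
  rw [← support_sum_monomial_coeff p]
  simp only [map_sum, ← sum_sub_distrib, mul_sum, ← sum_add_distrib, sum_mul]
  rw [sum_comm]
  exact sum_congr rfl fun d hd => hmonomial d hd _

end Polynomial

section NonnegPolynomial

variable {σ R : Type*} [CommSemiring R] [LinearOrder R] [IsStrictOrderedRing R]
  {p : MvPolynomial σ R} {x : σ → R}

theorem eval_pos (hp : ∀ d, 0 ≤ coeff d p) (hp0 : p ≠ 0) (hx : ∀ j, 0 < x j) : 0 < eval x p := by
  rw [eval_eq]
  refine sum_pos (fun d hd => mul_pos ((hp d).lt_of_ne' (mem_support_iff.1 hd)) ?_)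
    (support_nonempty.2 hp0)
  exact prod_pos fun j _ => pow_pos (hx j) _

theorem coeff_mul_pow_degree_le_eval (hp : ∀ d, 0 ≤ coeff d p) {m : R} (hm : 0 ≤ m)
    (hx : ∀ j, m ≤ x j) (d : σ →₀ ℕ) : coeff d p * m ^ d.degree ≤ eval x p := by
  have hterm : ∀ e, 0 ≤ coeff e p * ∏ j ∈ e.support, x j ^ e j := fun e =>
    mul_nonneg (hp e) (prod_nonneg fun j _ => pow_nonneg (hm.trans (hx j)) _)
  calc coeff d p * m ^ d.degree = coeff d p * ∏ j ∈ d.support, m ^ d j := by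
        rw [prod_pow_eq_pow_sum, Finsupp.degree_apply]
    _ ≤ coeff d p * ∏ j ∈ d.support, x j ^ d j := by
        gcongr with j
        exacts [hp d, hx j]
    _ ≤ eval x p := by
        rw [eval_eq]
        by_cases hd : d ∈ p.support
        · exact single_le_sum (f := fun e => coeff e p * ∏ j ∈ e.support, x j ^ e j)
            (fun e _ => hterm e) hd
        · rw [notMem_support_iff.1 hd, zero_mul]
          exact sum_nonneg fun e _ => hterm e

end NonnegPolynomial

section Jacobian

variable {n : ℕ} {f : PolySystem n} {x y : Fin n → ℝ}

theorem NonnegCoeffs.pderiv (hf : NonnegCoeffs f) (j : Fin n) :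
    NonnegCoeffs fun i => MvPolynomial.pderiv j (f i) := by
  intro i d
  rw [coeff_pderiv]
  exact mul_nonneg (hf i _) (by positivity)

theorem jacobian_nonneg (hf : NonnegCoeffs f) (hx : 0 ≤ x) (i j : Fin n) : 0 ≤ jacobian f x i j :=
  value_nonneg (hf.pderiv j) hx i

theorem jacobian_mono (hf : NonnegCoeffs f) (hx : 0 ≤ x) (hxy : x ≤ y) (i j : Fin n) :
    jacobian f x i j ≤ jacobian f y i j :=
  value_mono (hf.pderiv j) hx hxy i

theorem continuous_value (f : PolySystem n) : Continuous (value f) :=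
  continuous_pi fun i => continuous_eval (f i)

theorem continuous_jacobian (f : PolySystem n) : Continuous (jacobian f) :=
  continuous_matrix fun i j => continuous_eval (pderiv j (f i))

theorem DependsDirectly.jacobian_pos (hf : NonnegCoeffs f) {i l : Fin n}
    (h : DependsDirectly f i l) (hx : ∀ j, 0 < x j) : 0 < jacobian f x i l :=
  eval_pos (hf.pderiv l i) h hx

end Jacobian

section Taylor

variable {n : ℕ} {f : PolySystem n} {x y : Fin n → ℝ}

theorem Quadratic.value_eq (hq : Quadratic f) (x y : Fin n → ℝ) :
    value f y = value f x + jacobian f x *ᵥ (y - x) +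
      (2⁻¹ : ℝ) • (jacobian f y - jacobian f x) *ᵥ (y - x) := by
  have htrapezoid : (2 : ℝ) • (value f y - value f x) =
      (jacobian f x + jacobian f y) *ᵥ (y - x) :=
    funext fun i => two_mul_eval_sub_eval (hq i) x y
  rw [add_mulVec] at htrapezoid
  rw [sub_mulVec]
  linear_combination (norm := module) (2⁻¹ : ℝ) • htrapezoid

theorem jacobian_sub_mulVec_nonneg (hf : NonnegCoeffs f) (hx : 0 ≤ x) (hxy : x ≤ y)
    {v : Fin n → ℝ} (hv : 0 ≤ v) : 0 ≤ (jacobian f y - jacobian f x) *ᵥ v :=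
  mulVec_nonneg (fun i j => sub_nonneg.2 (jacobian_mono hf hx hxy i j)) hv

theorem Quadratic.value_add_jacobian_mulVec_le (hq : Quadratic f) (hf : NonnegCoeffs f)
    (hx : 0 ≤ x) (hxy : x ≤ y) : value f x + jacobian f x *ᵥ (y - x) ≤ value f y := by
  rw [hq.value_eq x y]
  exact le_add_of_nonneg_right <| smul_nonneg (by norm_num) <|
    jacobian_sub_mulVec_nonneg hf hx hxy (sub_nonneg.2 hxy)

end Taylor

section Subsolution

variable {n : ℕ} {f : PolySystem n} {x : Fin n → ℝ}

/-- The vectors `0 ≤ x ≤ μf` with `x ≤ f(x)`, among which are the Kleene and Newton iterates. -/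
structure IsSubsolution (f : PolySystem n) (x : Fin n → ℝ) : Prop where
  nonneg : 0 ≤ x
  le_value : x ≤ value f x
  le_lfp : x ≤ lfp f

theorem IsMSP.lfp_mem (hf : IsMSP f) : lfp f ∈ fixedPoints f :=
  (lfp_isLeast hf.nonneg hf.feasible).1

theorem IsMSP.lfp_le (hf : IsMSP f) (hx : x ∈ fixedPoints f) : lfp f ≤ x :=
  (lfp_isLeast hf.nonneg hf.feasible).2 hx

theorem IsSubsolution.value_le_lfp (h : IsSubsolution f x) (hf : IsMSP f) :
    value f x ≤ lfp f :=
  (value_mono hf.nonneg h.nonneg h.le_lfp).trans_eq hf.lfp_mem.2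

theorem isSubsolution_zero (hf : IsMSP f) : IsSubsolution f 0 :=
  ⟨le_rfl, value_nonneg hf.nonneg le_rfl, hf.lfp_mem.1⟩

theorem isSubsolution_kleene (hf : IsMSP f) (k : ℕ) : IsSubsolution f (kleene f k) := by
  induction k with
  | zero => exact isSubsolution_zero hf
  | succ k ih =>
    rw [kleene_succ]
    exact ⟨value_nonneg hf.nonneg ih.nonneg, value_mono hf.nonneg ih.nonneg ih.le_value,
      ih.value_le_lfp hf⟩

theorem IsMSP.lfp_pos (hf : IsMSP f) (i : Fin n) : 0 < lfp f i :=
  let ⟨k, hk⟩ := hf.clean i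
  hk.trans_le ((isSubsolution_kleene hf k).le_lfp i)

theorem tendsto_kleene (hf : IsMSP f) : Tendsto (kleene f) atTop (𝓝 (lfp f)) := by
  have hmono : Monotone (kleene f) := monotone_nat_of_le_succ fun k =>
    kleene_succ f k ▸ (isSubsolution_kleene hf k).le_value
  have hle : ∀ k, kleene f k ≤ lfp f := fun k => (isSubsolution_kleene hf k).le_lfp
  have hlim := tendsto_atTop_ciSup hmono ⟨lfp f, Set.forall_mem_range.2 hle⟩
  convert hlim
  refine (hf.lfp_le ⟨ge_of_tendsto' hlim fun k => (isSubsolution_kleene hf k).nonneg, ?_⟩).antisymm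
    (ciSup_le hle)
  exact isFixedPt_of_tendsto_iterate hlim (continuous_value f).continuousAt

theorem IsSubsolution.jacobian_mulVec_sub_le (h : IsSubsolution f x) (hf : IsMSP f)
    (hq : Quadratic f) : jacobian f x *ᵥ (lfp f - x) ≤ lfp f - x := by
  have htangent := hq.value_add_jacobian_mulVec_le hf.nonneg h.nonneg h.le_lfp
  rw [hf.lfp_mem.2] at htangent
  exact (le_sub_iff_add_le'.2 htangent).trans (sub_le_sub_left h.le_value _)

end Subsolution

section ConeVector

variable {n : ℕ} {f : PolySystem n}

theorem IsSubsolution.jacobian_lfp_mulVec_sub_le {x : Fin n → ℝ} (h : IsSubsolution f x)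
    (hf : IsMSP f) (hq : Quadratic f) (hx : value f x = lfp f) :
    jacobian f (lfp f) *ᵥ (lfp f - x) ≤ lfp f - x := by
  have hsub := sub_nonneg.2 h.le_lfp
  have hexact := hq.value_eq x (lfp f)
  rw [hf.lfp_mem.2, hx, sub_mulVec] at hexact
  calc jacobian f (lfp f) *ᵥ (lfp f - x) = -(jacobian f x *ᵥ (lfp f - x)) := by
        linear_combination (norm := module) (-2 : ℝ) • hexact
    _ ≤ 0 := neg_nonpos.2 (mulVec_nonneg (jacobian_nonneg hf.nonneg h.nonneg) hsub)
    _ ≤ lfp f - x := hsub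

/-- The normalised Kleene errors accumulate at a cone vector. If the Kleene sequence reaches `μf`,
its last nonzero error already is one. -/
theorem exists_nonneg_jacobian_lfp_mulVec_le [NeZero n] (hf : IsMSP f) (hq : Quadratic f) :
    ∃ d, 0 ≤ d ∧ d ≠ 0 ∧ jacobian f (lfp f) *ᵥ d ≤ d := by
  by_contra! hnone
  have hsub := isSubsolution_kleene hf
  have herr : ∀ k, 0 ≤ lfp f - kleene f k := fun k => sub_nonneg.2 (hsub k).le_lfp
  have hne : ∀ k, lfp f - kleene f k ≠ 0 := by
    intro k
    induction k with
    | zero => exact fun h => (hf.lfp_pos 0).ne' (congrFun (sub_eq_zero.1 h) 0)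
    | succ k ih =>
      rw [kleene_succ, sub_ne_zero]
      exact fun h => hnone _ (herr k) ih ((hsub k).jacobian_lfp_mulVec_sub_le hf hq h.symm)
  obtain ⟨d, hd, hd0, hJd⟩ := exists_nonneg_mulVec_le_of_tendsto
    (((continuous_jacobian f).tendsto _).comp (tendsto_kleene hf)) herr hne
    fun k => (hsub k).jacobian_mulVec_sub_le hf hq
  exact hnone d hd hd0 hJd

theorem exists_pos_jacobian_lfp_mulVec_le [NeZero n] (hf : IsMSP f) (hq : Quadratic f)
    (hsc : StronglyConnected f) :
    ∃ d : Fin n → ℝ, (∀ i, 0 < d i) ∧ jacobian f (lfp f) *ᵥ d ≤ d := by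
  obtain ⟨d, hd, hd0, hJd⟩ := exists_nonneg_jacobian_lfp_mulVec_le hf hq
  refine ⟨d, ?_, hJd⟩
  exact (pos_or_eq_zero_of_mulVec_le hsc (jacobian_nonneg hf.nonneg hf.lfp_mem.1) hd hJd
    fun i _ l h => h.jacobian_pos hf.nonneg hf.lfp_pos).resolve_right hd0

end ConeVector

section Newton

variable {n : ℕ} {f : PolySystem n} {x : Fin n → ℝ}

theorem newton_succ (f : PolySystem n) (k : ℕ) : newton f (k + 1) = newtonOp f (newton f k) :=
  Function.iterate_succ_apply' _ _ _

theorem newtonOp_lfp (hf : IsMSP f) : newtonOp f (lfp f) = lfp f := by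
  rw [newtonOp, hf.lfp_mem.2, sub_self, mulVec_zero, add_zero]

theorem one_sub_jacobian_mulVec_newtonOp_sub (h : IsUnit (1 - jacobian f x).det) :
    (1 - jacobian f x) *ᵥ (newtonOp f x - x) = value f x - x := by
  rw [newtonOp, add_sub_cancel_left, mulVec_mulVec, mul_nonsing_inv _ h, one_mulVec]

theorem Quadratic.one_sub_jacobian_mulVec_sub_newtonOp (hq : Quadratic f)
    (h : IsUnit (1 - jacobian f x).det) {y : Fin n → ℝ} (hy : value f y = y) :
    (1 - jacobian f x) *ᵥ (y - newtonOp f x) =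
      (2⁻¹ : ℝ) • (jacobian f y - jacobian f x) *ᵥ (y - x) := by
  have hstep := one_sub_jacobian_mulVec_newtonOp_sub h
  have htaylor := hq.value_eq x y
  rw [hy] at htaylor
  rw [← sub_sub_sub_cancel_right y (newtonOp f x) x, mulVec_sub, hstep, sub_mulVec, one_mulVec]
  linear_combination (norm := module) htaylor

theorem isSubsolution_newtonOp (h : IsSubsolution f x) (hf : IsMSP f) (hq : Quadratic f)
    (hmono : IsMonotoneMatrix (1 - jacobian f x)) : IsSubsolution f (newtonOp f x) := by
  have hstep := one_sub_jacobian_mulVec_newtonOp_sub hmono.isUnit_det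
  have hle : x ≤ newtonOp f x :=
    sub_nonneg.1 (hmono (by rw [hstep]; exact sub_nonneg.2 h.le_value))
  refine ⟨h.nonneg.trans hle, ?_, sub_nonneg.1 (hmono ?_)⟩
  · calc newtonOp f x = value f x + jacobian f x *ᵥ (newtonOp f x - x) := by
          rw [sub_mulVec, one_mulVec] at hstep
          linear_combination (norm := module) hstep
      _ ≤ value f (newtonOp f x) := hq.value_add_jacobian_mulVec_le hf.nonneg h.nonneg hle
  · rw [hq.one_sub_jacobian_mulVec_sub_newtonOp hmono.isUnit_det hf.lfp_mem.2]
    exact smul_nonneg (by norm_num) (jacobian_sub_mulVec_nonneg hf.nonneg h.nonneg h.le_lfp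
      (sub_nonneg.2 h.le_lfp))

theorem IsSubsolution.lfp_sub_newtonOp_le (h : IsSubsolution f x) (hf : IsMSP f)
    (hq : Quadratic f) (hmono : IsMonotoneMatrix (1 - jacobian f x)) {d : Fin n → ℝ}
    (hd : jacobian f (lfp f) *ᵥ d ≤ d) {c : ℝ} (hc : 0 ≤ c) (hxd : lfp f - x ≤ (2 * c) • d) :
    lfp f - newtonOp f x ≤ c • d := by
  refine sub_nonneg.1 (hmono ?_)
  have hJ := jacobian_sub_mulVec_nonneg hf.nonneg h.nonneg h.le_lfp (sub_nonneg.2 hxd)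
  have hcd := smul_nonneg hc (sub_nonneg.2 hd)
  rw [mulVec_sub, hq.one_sub_jacobian_mulVec_sub_newtonOp hmono.isUnit_det hf.lfp_mem.2]
  calc 0 ≤ c • (d - jacobian f (lfp f) *ᵥ d) + (2⁻¹ : ℝ) •
        (jacobian f (lfp f) - jacobian f x) *ᵥ ((2 * c) • d - (lfp f - x)) :=
      add_nonneg hcd (smul_nonneg (by norm_num) hJ)
    _ = _ := by
      simp only [mulVec_sub, sub_mulVec, mulVec_smul, one_mulVec]
      module

theorem IsSubsolution.jacobian_apply_eq (h : IsSubsolution f x) (hf : NonnegCoeffs f)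
    (hlt : ∀ i, x i < lfp f i) {i : Fin n}
    (hi : ((jacobian f (lfp f) - jacobian f x) *ᵥ (lfp f - x)) i ≤ 0) (l : Fin n) :
    jacobian f x i l = jacobian f (lfp f) i l :=
  (sub_eq_zero.1 <| eq_zero_of_mulVec_apply_nonpos
    (fun i j => sub_nonneg.2 (jacobian_mono hf h.nonneg h.le_lfp i j))
    (fun j => sub_pos.2 (hlt j)) hi l).symm

theorem IsSubsolution.isMonotoneMatrix [NeZero n] (h : IsSubsolution f x) (hf : IsMSP f)
    (hq : Quadratic f) (hsc : StronglyConnected f) (hlt : ∀ i, x i < lfp f i) :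
    IsMonotoneMatrix (1 - jacobian f x) := by
  have htaylor := hq.value_eq x (lfp f)
  rw [hf.lfp_mem.2] at htaylor
  have hrow : ∀ i, (jacobian f x *ᵥ (lfp f - x)) i = (lfp f - x) i →
      value f x i ≤ x i ∧ ((jacobian f (lfp f) - jacobian f x) *ᵥ (lfp f - x)) i ≤ 0 := by
    intro i hi
    have htaylor_i := congrFun htaylor i
    have hle := h.le_value i
    have hgap := jacobian_sub_mulVec_nonneg hf.nonneg h.nonneg h.le_lfp (sub_nonneg.2 h.le_lfp) i
    simp only [Pi.add_apply, Pi.smul_apply, smul_eq_mul, Pi.zero_apply, hi, Pi.sub_apply]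
      at htaylor_i hgap
    constructor <;> linarith
  refine isMonotoneMatrix_one_sub hsc (jacobian_nonneg hf.nonneg h.nonneg)
    (fun i => sub_pos.2 (hlt i)) (h.jacobian_mulVec_sub_le hf hq) (fun heq => ?_)
    fun i hi l hl => ?_
  · have hfix : value f x ≤ x := fun i => (hrow i (congrFun heq i)).1
    exact (hlt 0).not_ge (hf.lfp_le ⟨h.nonneg, hfix.antisymm h.le_value⟩ 0)
  · rw [h.jacobian_apply_eq hf.nonneg hlt (hrow i hi).2 l]
    exact hl.jacobian_pos hf.nonneg hf.lfp_pos

/-- The invariant of the Newton sequence: the next step is well defined, and the iterate lies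
strictly below `μf` in every component unless it has already reached `μf`. -/
structure IsNewtonPoint (f : PolySystem n) (x : Fin n → ℝ) : Prop extends IsSubsolution f x where
  isMonotoneMatrix : IsMonotoneMatrix (1 - jacobian f x)
  lt_or_eq : (∀ i, x i < lfp f i) ∨ x = lfp f

theorem isNewtonPoint_newtonOp [NeZero n] (h : IsNewtonPoint f x) (hf : IsMSP f)
    (hq : Quadratic f) (hsc : StronglyConnected f) : IsNewtonPoint f (newtonOp f x) := by
  rcases h.lt_or_eq with hlt | rfl
  swap
  · rwa [newtonOp_lfp hf]
  have hmono := h.isMonotoneMatrix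
  have hsub := isSubsolution_newtonOp h.toIsSubsolution hf hq hmono
  have herr : 0 ≤ lfp f - newtonOp f x := sub_nonneg.2 hsub.le_lfp
  have hgap := jacobian_sub_mulVec_nonneg hf.nonneg h.nonneg h.le_lfp (sub_nonneg.2 h.le_lfp)
  have hJ := jacobian_nonneg hf.nonneg h.nonneg
  have hJerr : lfp f - newtonOp f x - jacobian f x *ᵥ (lfp f - newtonOp f x) =
      (2⁻¹ : ℝ) • (jacobian f (lfp f) - jacobian f x) *ᵥ (lfp f - x) := by
    rw [← hq.one_sub_jacobian_mulVec_sub_newtonOp hmono.isUnit_det hf.lfp_mem.2, sub_mulVec,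
      one_mulVec]
  have hrow : ∀ i, (lfp f - newtonOp f x) i = 0 → ∀ l,
      jacobian f x i l = jacobian f (lfp f) i l := by
    intro i hi
    refine h.jacobian_apply_eq hf.nonneg hlt ?_
    have hJerr_i := congrFun hJerr i
    have hJ_i := mulVec_nonneg hJ herr i
    rw [Pi.sub_apply, hi, Pi.smul_apply, smul_eq_mul] at hJerr_i
    rw [Pi.zero_apply] at hJ_i
    linarith
  rcases pos_or_eq_zero_of_mulVec_le hsc hJ herr
    (sub_nonneg.1 (hJerr ▸ smul_nonneg (by norm_num) hgap))
    fun i hi l hl => hrow i hi l ▸ hl.jacobian_pos hf.nonneg hf.lfp_pos with hpos | hzero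
  · have hlt' : ∀ i, newtonOp f x i < lfp f i := fun i => sub_pos.1 (hpos i)
    exact ⟨hsub, hsub.isMonotoneMatrix hf hq hsc hlt', Or.inl hlt'⟩
  · have hJeq : jacobian f x = jacobian f (newtonOp f x) := by
      rw [← sub_eq_zero.1 hzero]
      exact ext fun i l => hrow i (congrFun hzero i) l
    exact ⟨hsub, hJeq ▸ hmono, Or.inr (sub_eq_zero.1 hzero).symm⟩

theorem isNewtonPoint_newton [NeZero n] (hf : IsMSP f) (hq : Quadratic f)
    (hsc : StronglyConnected f) (k : ℕ) : IsNewtonPoint f (newton f k) := by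
  induction k with
  | zero =>
    have hsub := isSubsolution_zero hf
    exact ⟨hsub, hsub.isMonotoneMatrix hf hq hsc hf.lfp_pos, Or.inl hf.lfp_pos⟩
  | succ k ih => exact newton_succ f k ▸ isNewtonPoint_newtonOp ih hf hq hsc

theorem lfp_sub_newton_le [NeZero n] (hf : IsMSP f) (hq : Quadratic f)
    (hsc : StronglyConnected f) {d : Fin n → ℝ} (hd : jacobian f (lfp f) *ᵥ d ≤ d)
    (hlfp : lfp f ≤ d) (k : ℕ) : lfp f - newton f k ≤ ((2 : ℝ) ^ k)⁻¹ • d := by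
  induction k with
  | zero =>
    rw [pow_zero, inv_one, one_smul]
    exact (sub_le_self _ le_rfl).trans hlfp
  | succ k ih =>
    have hk := isNewtonPoint_newton hf hq hsc k
    rw [newton_succ]
    refine hk.lfp_sub_newtonOp_le hf hq hk.isMonotoneMatrix hd (by positivity) ?_
    rwa [pow_succ', mul_inv, mul_inv_cancel_left₀ two_ne_zero]

end Newton

section Bounds

variable {n : ℕ} {f : PolySystem n} {i : Fin n}

theorem finite_setOf_coeff (f : PolySystem n) :
    {c | c ≠ 0 ∧ ∃ i d, coeff d (f i) = c}.Finite := by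
  refine (Set.finite_iUnion fun i =>
    ((f i).support.image fun d => coeff d (f i)).finite_toSet).subset ?_
  rintro _ ⟨hc, i, d, rfl⟩
  exact Set.mem_iUnion.2 ⟨i, mem_image_of_mem _ (mem_support_iff.2 hc)⟩

theorem cMin_le {d : Fin n →₀ ℕ} (h : coeff d (f i) ≠ 0) : cMin f ≤ coeff d (f i) :=
  csInf_le (finite_setOf_coeff f).bddBelow ⟨h, i, d, rfl⟩

theorem cMin_pos (hf : NonnegCoeffs f) (hi : f i ≠ 0) : 0 < cMin f := by
  obtain ⟨d, hd⟩ := MvPolynomial.ne_zero_iff.1 hi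
  obtain ⟨hne, j, e, he⟩ : cMin f ∈ {c | c ≠ 0 ∧ ∃ i d, coeff d (f i) = c} :=
    Set.Nonempty.csInf_mem ⟨_, hd, i, d, rfl⟩ (finite_setOf_coeff f)
  exact (he ▸ hf j e).lt_of_ne' hne

theorem muMin_le (f : PolySystem n) (i : Fin n) : muMin f ≤ lfp f i :=
  ciInf_le (Set.finite_range _).bddBelow i

theorem le_muMax (f : PolySystem n) (i : Fin n) : lfp f i ≤ muMax f :=
  le_ciSup (Set.finite_range _).bddAbove i

theorem muMin_pos [NeZero n] (hf : IsMSP f) : 0 < muMin f :=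
  let ⟨i, hi⟩ := exists_eq_ciInf_of_finite (f := lfp f)
  (hf.lfp_pos i).trans_eq hi

theorem DependsDirectly.cMin_mul_min_le_jacobian (hf : NonnegCoeffs f) (hq : Quadratic f)
    {l : Fin n} (h : DependsDirectly f i l) {x : Fin n → ℝ} {m : ℝ} (hm : 0 ≤ m)
    (hx : ∀ j, m ≤ x j) : cMin f * min m 1 ≤ jacobian f x i l := by
  obtain ⟨d, hd⟩ := MvPolynomial.ne_zero_iff.1 h
  have hcoeff := coeff_pderiv (i := l) (f i) d
  have hne : coeff (d + Finsupp.single l 1) (f i) ≠ 0 := left_ne_zero_of_mul (hcoeff ▸ hd)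
  have hdeg : d.degree ≤ 1 := by
    have : (d + Finsupp.single l 1).degree ≤ 2 :=
      (le_totalDegree (mem_support_iff.2 hne)).trans (hq i)
    rw [map_add, Finsupp.degree_single] at this
    lia
  have hm' : 0 ≤ min m 1 := le_min hm zero_le_one
  calc cMin f * min m 1 ≤ coeff d (pderiv l (f i)) * min m 1 ^ d.degree := by
        refine mul_le_mul ?_ ?_ hm' (hf.pderiv l i d)
        · exact (cMin_le hne).trans (hcoeff ▸ le_mul_of_one_le_right (hf i _) (by simp))
        · simpa using pow_le_pow_of_le_one hm' (min_le_right m 1) hdeg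
    _ ≤ jacobian f x i l :=
        coeff_mul_pow_degree_le_eval (hf.pderiv l i) hm'
          (fun j => (min_le_left m 1).trans (hx j)) d

theorem DependsDirectly.mul_le_of_jacobian_lfp_mulVec_le (hf : IsMSP f)
    (hq : Quadratic f) {l : Fin n} (h : DependsDirectly f i l) {d : Fin n → ℝ} (hd : 0 ≤ d)
    (hJd : jacobian f (lfp f) *ᵥ d ≤ d) : cMin f * min (muMin f) 1 * d l ≤ d i := by
  have : NeZero n := ⟨i.pos.ne'⟩
  calc cMin f * min (muMin f) 1 * d l ≤ jacobian f (lfp f) i l * d l :=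
        mul_le_mul_of_nonneg_right
          (h.cMin_mul_min_le_jacobian hf.nonneg hq (muMin_pos hf).le (muMin_le f)) (hd l)
    _ ≤ (jacobian f (lfp f) *ᵥ d) i :=
        mul_le_mulVec (jacobian_nonneg hf.nonneg hf.lfp_mem.1) hd i l
    _ ≤ d i := hJd i

/-- For `n = 1` the constant `c_min · min {μ_min, 1}` need not be at most `1`, hence the case
split on `j = m`. -/
theorem apply_le_two_pow_mul_lfp (hf : IsMSP f) (hq : Quadratic f) (hsc : StronglyConnected f)
    {d : Fin n → ℝ} (hd : ∀ i, 0 < d i) (hJd : jacobian f (lfp f) *ᵥ d ≤ d) {m : Fin n}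
    (hm : d m = lfp f m) (j : Fin n) : d j ≤ 2 ^ ⌈threshold f⌉₊ * lfp f j := by
  rcases eq_or_ne j m with rfl | hjm
  · exact hm.trans_le (le_mul_of_one_le_left (hf.lfp_pos j).le (one_le_pow₀ one_le_two))
  have : NeZero n := ⟨m.pos.ne'⟩
  have : Nontrivial (Fin n) := ⟨j, m, hjm⟩
  have hmin := muMin_pos hf
  have hdep := exists_rel_of_forall_reflTransGen hsc
  have hc : 0 < cMin f :=
    let ⟨l, hl⟩ := hdep m
    cMin_pos (i := m) hf.nonneg fun h0 => hl (by rw [h0, map_zero])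
  set q := cMin f * min (muMin f) 1 with hq_def
  have hq0 : 0 < q := mul_pos hc (lt_min hmin one_pos)
  have hstep : ∀ i l, DependsDirectly f i l → q * d l ≤ d i := fun i l h =>
    h.mul_le_of_jacobian_lfp_mulVec_le hf hq (fun l => (hd l).le) hJd
  have hq1 : q ≤ 1 := le_one_of_forall_mul_le hdep hd hstep
  have hspread : q ^ (n - 1) * d j ≤ d m := by
    simpa using pow_card_sub_one_mul_le hsc (fun i => (hd i).le) hq0.le hq1 hstep m j
  have hmax : muMin f ≤ muMax f := (muMin_le f m).trans (le_muMax f m)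
  have hratio : muMax f / (q * muMin f) = muMax f / (cMin f * muMin f * min (muMin f) 1) := by
    rw [hq_def, mul_right_comm]
  calc d j ≤ d m / q ^ (n - 1) := (le_div_iff₀' (pow_pos hq0 _)).2 hspread
    _ ≤ muMax f / q ^ (n - 1) := by
        gcongr
        exact hm.trans_le (le_muMax f m)
    _ ≤ (muMax f / (q * muMin f)) ^ n * muMin f := by
        simpa [Nat.sub_add_cancel m.pos] using
          div_pow_le_div_mul_pow_mul hmin hmax hq0 hq1 (n - 1)
    _ ≤ 2 ^ ⌈threshold f⌉₊ * lfp f j := by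
        rw [threshold, ← hratio]
        gcongr
        · exact pow_le_two_pow_ceil_mul_logb (div_pos (hmin.trans_le hmax) (by positivity)) n
        · exact muMin_le f j

theorem exists_jacobian_lfp_mulVec_le_and_le_two_pow_smul [NeZero n] (hf : IsMSP f)
    (hq : Quadratic f) (hsc : StronglyConnected f) :
    ∃ d, jacobian f (lfp f) *ᵥ d ≤ d ∧ lfp f ≤ d ∧ d ≤ (2 : ℝ) ^ ⌈threshold f⌉₊ • lfp f := by
  obtain ⟨d, hd, hJd⟩ := exists_pos_jacobian_lfp_mulVec_le hf hq hsc
  obtain ⟨t, m, ht, hm⟩ := exists_le_smul_and_apply_eq (lfp f) hd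
  have ht0 : 0 < t := pos_of_mul_pos_left ((hf.lfp_pos m).trans_eq hm) (hd m).le
  have hJtd : jacobian f (lfp f) *ᵥ (t • d) ≤ t • d := by
    rw [mulVec_smul]
    exact smul_le_smul_of_nonneg_left hJd ht0.le
  exact ⟨t • d, hJtd, ht,
    apply_le_two_pow_mul_lfp hf hq hsc (fun i => mul_pos ht0 (hd i)) hJtd hm.symm⟩

end Bounds

end MSP

theorem theorem3p2 {n : ℕ} (hn : 0 < n) (f : MSP.PolySystem n)
    (hf : MSP.IsMSP f) (hquad : MSP.Quadratic f) (hsc : MSP.StronglyConnected f) :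
    (∀ k : ℕ, IsUnit (1 - MSP.jacobian f (MSP.newton f k)).det) ∧
    ∀ i : ℕ, MSP.HasValidBits i (MSP.lfp f) (MSP.newton f (⌈MSP.threshold f⌉₊ + i)) := by
  have : NeZero n := ⟨hn.ne'⟩
  have hnewton := MSP.isNewtonPoint_newton hf hquad hsc
  refine ⟨fun k => (hnewton k).isMonotoneMatrix.isUnit_det, fun i j => ?_⟩
  obtain ⟨d, hJd, hle, hd⟩ :=
    MSP.exists_jacobian_lfp_mulVec_le_and_le_two_pow_smul hf hquad hsc
  set K := ⌈MSP.threshold f⌉₊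
  have hpos := hf.lfp_pos j
  rw [abs_of_nonneg (sub_nonneg.2 ((hnewton _).le_lfp j)), abs_of_pos hpos, div_le_iff₀ hpos,
    zpow_neg, zpow_natCast]
  calc MSP.lfp f j - MSP.newton f (K + i) j ≤ (2 ^ (K + i))⁻¹ * d j :=
        MSP.lfp_sub_newton_le hf hquad hsc hJd hle (K + i) j
    _ ≤ (2 ^ (K + i))⁻¹ * (2 ^ K * MSP.lfp f j) := by gcongr; exact hd j
    _ = (2 ^ i)⁻¹ * MSP.lfp f j := by rw [pow_add]; field_simp
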